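/- Let $\mathbb{T}$ be the unit circle with normalized Lebesgue measure and let $H^2\subset L^2(\mathbb{T})$ be the Hardy space of the unit disc, identified through boundary values with the subspace of those $f\in L^2(\mathbb{T})$ whose Fourier coefficients of negative index all vanish. For an inner function $u$ let $K_u=H^2\ominus uH^2$ be the model space of $u$, and for $\delta>0$ let $\phi^\delta(z)=\exp\left(-\delta\frac{1-z}{1+z}\right)$. For $g\in L^\infty(\mathbb{T})$ let $$c(g)=\overline{gK_{z\phi^\delta}}$$ denote the closure in $L^2(\mathbb{T})$ of $\{gf: f\in K_{z\phi^\delta}\}$. Theorem. Let $\delta>0$, let $N\ge 1$ be an integer, let $w_1,\dots,w_N\in\mathbb{T}$, and put $\widetilde p_N(z)=\prod_{j=1}^N(z+w_j)$. Let $h$ be a rational function which belongs to $L^\infty(\mathbb{T})$ and is invertible in $L^\infty(\mathbb{T})$, and let $g=\widetilde p_N h$. Then $$c(g)+h\phi^\delta K_{z^N}=hK_{z^{N+1}\phi^\delta},$$ where the sum is the algebraic sum of subspaces. In particular, $c(g)$ is contained in $hK_{z^{N+1}\phi^\delta}$ and has codimension at most $N$ in it, that is, $\dim\left(hK_{z^{N+1}\phi^\delta}/c(g)\right)\le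 N$. -/

import Mathlib

open MeasureTheory AddCircle
open scoped ENNReal

noncomputable section

namespace DiscHardy

/-- `L²(𝕋)` for normalized Lebesgue measure. The unit circle is parametrized by
`t ↦ toCircle t = exp (2πit)`, `t ∈ ℝ/ℤ`, which carries `haarAddCircle` to normalized arc length. -/
abbrev L2T : Type := Lp ℂ 2 (haarAddCircle (T := (1 : ℝ)))

/-- The function `t ↦ g (exp (2πit))` on `ℝ/ℤ` that represents a function `g` on the unit circle. -/
def onCircle (g : Circle → ℂ) : UnitAddCircle → ℂ := fun t => g (toCircle t)

/-- The subspace `gM = {gf : f ∈ M}` of `L²(𝕋)`; for `g ∈ L^∞(𝕋)` this is the image of `M` under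
multiplication by `g`. -/
def mulSpace (g : Circle → ℂ) (M : Submodule ℂ L2T) : Submodule ℂ L2T where
  carrier := {F | ∃ f ∈ M, F =ᵐ[haarAddCircle] fun t => onCircle g t * f t}
  zero_mem' := by
    refine ⟨0, M.zero_mem, Filter.Eventually.of_forall fun t => ?_⟩
    simp
  add_mem' := by
    rintro F G ⟨f, hf, hF⟩ ⟨k, hk, hG⟩
    refine ⟨f + k, M.add_mem hf hk, ?_⟩
    filter_upwards [hF, hG, Lp.coeFn_add F G, Lp.coeFn_add f k] with t h1 h2 h3 h4
    simp only [h3, h4, Pi.add_apply, h1, h2]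
    ring
  smul_mem' := by
    rintro c F ⟨f, hf, hF⟩
    refine ⟨c • f, M.smul_mem c hf, ?_⟩
    filter_upwards [hF, Lp.coeFn_smul c F, Lp.coeFn_smul c f] with t h1 h2 h3
    simp only [h2, h3, Pi.smul_apply, h1, smul_eq_mul]
    ring

/-- The Hardy space `H²` of the disc, identified through boundary values
(`∑ aₙ zⁿ ↦ ∑ aₙ exp (2πint)`) with the space of those `f ∈ L²(𝕋)` all of whose Fourier
coefficients with negative index vanish. -/
def hardy : Submodule ℂ L2T where
  carrier := {f | ∀ n : ℤ, n < 0 → fourierCoeff (f : UnitAddCircle → ℂ) n = 0}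
  zero_mem' := by
    intro n _
    rw [← fourierBasis_repr]
    simp
  add_mem' := by
    intro f k hf hk n hn
    have h1 := hf n hn
    have h2 := hk n hn
    rw [← fourierBasis_repr] at h1 h2 ⊢
    simp [h1, h2]
  smul_mem' := by
    intro c f hf n hn
    have h1 := hf n hn
    rw [← fourierBasis_repr] at h1 ⊢
    simp [h1]

/-- The model space `K_u = H² ⊖ uH²`, for an inner function with boundary function `u`. -/
def modelSpace (u : Circle → ℂ) : Submodule ℂ L2T :=
  hardy ⊓ (mulSpace u hardy)ᗮ

/-- The boundary function of the singular inner function `φ^δ(z) = exp (-δ (1 - z) / (1 + z))`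
(defined off the null set `{-1}`). -/
def phi (δ : ℝ) (z : Circle) : ℂ :=
  Complex.exp (-(δ : ℂ) * ((1 - (z : ℂ)) / (1 + (z : ℂ))))

/-- `c(g)`, the closure in `L²(𝕋)` of `g K_{zφ^δ}`. -/
def cSpace (δ : ℝ) (g : Circle → ℂ) : Submodule ℂ L2T :=
  (mulSpace g (modelSpace fun z => (z : ℂ) * phi δ z)).topologicalClosure

/-- `pTilde w` is the polynomial `∏ⱼ (z + wⱼ)` as a function on the circle. -/
def pTilde {N : ℕ} (w : Fin N → Circle) (z : Circle) : ℂ :=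
  ∏ j, ((z : ℂ) + (w j : ℂ))

/-- The function on the circle given by a rational function. -/
def ratOnCircle (h : RatFunc ℂ) (z : Circle) : ℂ :=
  h.eval (RingHom.id ℂ) (z : ℂ)

/-- `g` belongs to `L^∞(𝕋)` and is an invertible element of that algebra. -/
def IsInvertibleLInfty (g : Circle → ℂ) : Prop :=
  MemLp (onCircle g) ∞ (haarAddCircle (T := (1 : ℝ))) ∧
    ∃ k : Circle → ℂ, MemLp (onCircle k) ∞ (haarAddCircle (T := (1 : ℝ))) ∧
      ∀ᵐ t ∂(haarAddCircle (T := (1 : ℝ))), onCircle g t * onCircle k t = 1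

end DiscHardy

end

namespace DiscHardy

open scoped ComplexConjugate InnerProductSpace

/-! ### Multiplication operators -/

/-! Multiplication by `h` is a homeomorphism of `L²(𝕋)`, so it commutes with closures and the
theorem reduces to `h = 1`. What remains holds for every inner `u` and is `closure_pTilde_sup`: with
`p = pTilde w`, the closure of `p K_{zu}` plus `u K_{z^N}` is `K_{z^{N+1}u}`.

Everything is read off Fourier coefficients: `K_{z^m u}` consists of the `f ∈ H²` for which `ū f`
has spectrum below `m` (`IsInner.mem_modelSpace`). The inclusion `≤` then follows from degree
counting. The sum is closed, being closed plus finite-dimensional, so equality follows once every `F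
∈ K_{z^{N+1}u}` orthogonal to both summands vanishes (`eq_zero_of_orthogonal`).

For such `F`, let `G = ū F`. Orthogonality to `u K_{z^N}` kills the coefficients of `G` at `0, …,
N-1`. Orthogonality to `p K_{zu}` gives `p̄ F = a + m` with `a ∈ zuH²` and `m ⟂ H²`. Since `p = C
z^N p̄` on the circle, with `C = ∏ wⱼ`, it follows that `p G = C z^N (ū a + ū m)`. Comparing
coefficients yields first that the coefficient of `G` at `N` is zero, then `a = 0`. Now `p F = C z^N
m` has spectrum below `N`; as the zeros of `p` lie on the circle, `F` has spectrum below `0`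
(`mem_specLt_of_mulOp_pTilde`), so `F = 0`.

The codimension bound is `dim K_{z^N} ≤ N`. -/

/-- `g` is (the restriction to the circle of) an element of `L^∞(𝕋)`. -/
def IsLInfty (g : Circle → ℂ) : Prop :=
  MemLp (onCircle g) ∞ (haarAddCircle (T := (1 : ℝ)))

theorem IsLInfty.of_bound {g : Circle → ℂ} (hg : Measurable (onCircle g)) (C : ℝ)
    (hC : ∀ z, ‖g z‖ ≤ C) : IsLInfty g :=
  memLp_top_of_bound hg.aestronglyMeasurable C
    (Filter.Eventually.of_forall fun t => hC (toCircle t))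

theorem IsLInfty.mul {a b : Circle → ℂ} (ha : IsLInfty a) (hb : IsLInfty b) :
    IsLInfty fun z => a z * b z :=
  MemLp.mul (p := ∞) (q := ∞) (r := ∞) hb ha

theorem IsLInfty.conj {a : Circle → ℂ} (ha : IsLInfty a) : IsLInfty fun z => conj (a z) :=
  MemLp.star ha

/-- Multiplication by an essentially bounded function, as an operator on `L²(𝕋)`. -/
noncomputable def mulOp {a : Circle → ℂ} (ha : IsLInfty a) : L2T →L[ℂ] L2T :=
  (ContinuousLinearMap.mul ℂ ℂ).holderL haarAddCircle ∞ 2 2 (MemLp.toLp _ ha)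

theorem coeFn_mulOp {a : Circle → ℂ} (ha : IsLInfty a) (f : L2T) :
    mulOp ha f =ᵐ[haarAddCircle] fun t => onCircle a t * f t := by
  have h := (ContinuousLinearMap.mul ℂ ℂ).coeFn_holder (r := 2) (MemLp.toLp _ ha) f
  filter_upwards [h, MemLp.coeFn_toLp ha] with t h1 h2
  rw [← h2]
  exact h1

theorem mulOp_congr_ae {a b : Circle → ℂ} (ha : IsLInfty a) (hb : IsLInfty b)
    (hab : onCircle a =ᵐ[haarAddCircle] onCircle b) (f : L2T) : mulOp ha f = mulOp hb f := by
  apply Lp.ext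
  filter_upwards [coeFn_mulOp ha f, coeFn_mulOp hb f, hab] with t h1 h2 h3
  rw [h1, h2, h3]

theorem mulOp_congr {a b : Circle → ℂ} (ha : IsLInfty a) (hb : IsLInfty b)
    (hab : ∀ z, a z = b z) (f : L2T) : mulOp ha f = mulOp hb f :=
  mulOp_congr_ae ha hb (Filter.Eventually.of_forall fun t => hab (toCircle t)) f

theorem mulOp_mulOp {a b : Circle → ℂ} (ha : IsLInfty a) (hb : IsLInfty b) (f : L2T) :
    mulOp ha (mulOp hb f) = mulOp (ha.mul hb) f := by
  apply Lp.ext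
  filter_upwards [coeFn_mulOp ha (mulOp hb f), coeFn_mulOp hb f,
    coeFn_mulOp (ha.mul hb) f] with t h1 h2 h3
  rw [h1, h2, h3]
  simp only [onCircle]
  ring

theorem mulOp_comm {a b : Circle → ℂ} (ha : IsLInfty a) (hb : IsLInfty b) (f : L2T) :
    mulOp ha (mulOp hb f) = mulOp hb (mulOp ha f) := by
  rw [mulOp_mulOp, mulOp_mulOp]
  exact mulOp_congr _ _ (fun z => mul_comm _ _) f

theorem mulOp_eq_smul {a : Circle → ℂ} (ha : IsLInfty a) {c : ℂ}
    (hc : ∀ᵐ t ∂(haarAddCircle (T := (1 : ℝ))), onCircle a t = c) (f : L2T) :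
    mulOp ha f = c • f := by
  apply Lp.ext
  filter_upwards [coeFn_mulOp ha f, Lp.coeFn_smul c f, hc] with t h1 h2 h3
  rw [h1, h2, h3, Pi.smul_apply, smul_eq_mul]

theorem mulOp_conj_mulOp {a : Circle → ℂ} (ha : IsLInfty a) (hn : ∀ z, ‖a z‖ = 1) (f : L2T) :
    mulOp ha.conj (mulOp ha f) = f := by
  rw [mulOp_mulOp, mulOp_eq_smul (c := 1) _ _ f, one_smul]
  refine Filter.Eventually.of_forall fun t => ?_
  simp only [onCircle]
  rw [Complex.conj_mul', hn]
  simp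

theorem mulOp_mulOp_conj {a : Circle → ℂ} (ha : IsLInfty a) (hn : ∀ z, ‖a z‖ = 1) (f : L2T) :
    mulOp ha (mulOp ha.conj f) = f := by
  rw [mulOp_comm, mulOp_conj_mulOp ha hn]

theorem inner_mulOp_left {a : Circle → ℂ} (ha : IsLInfty a) (f k : L2T) :
    ⟪mulOp ha f, k⟫_ℂ = ⟪f, mulOp ha.conj k⟫_ℂ := by
  rw [L2.inner_def, L2.inner_def]
  apply integral_congr_ae
  filter_upwards [coeFn_mulOp ha f, coeFn_mulOp ha.conj k] with t h1 h2
  rw [h1, h2]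
  simp only [RCLike.inner_apply, map_mul, onCircle]
  ring

theorem inner_mulOp_right {a : Circle → ℂ} (ha : IsLInfty a) (f k : L2T) :
    ⟪f, mulOp ha k⟫_ℂ = ⟪mulOp ha.conj f, k⟫_ℂ := by
  rw [← inner_conj_symm, inner_mulOp_left, inner_conj_symm]

theorem mulSpace_eq_map {a : Circle → ℂ} (ha : IsLInfty a) (M : Submodule ℂ L2T) :
    mulSpace a M = M.map (mulOp ha : L2T →ₗ[ℂ] L2T) := by
  ext F
  rw [Submodule.mem_map]
  constructor
  · rintro ⟨f, hf, hF⟩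
    exact ⟨f, hf, Lp.ext ((coeFn_mulOp ha f).trans hF.symm)⟩
  · rintro ⟨f, hf, rfl⟩
    exact ⟨f, hf, coeFn_mulOp ha f⟩

theorem mulSpace_congr {a b : Circle → ℂ} (hab : ∀ z, a z = b z) (M : Submodule ℂ L2T) :
    mulSpace a M = mulSpace b M := by
  rw [funext hab]

/-! ### Monomials and Fourier coefficients -/

theorem onCircle_zpow (n : ℤ) (t : UnitAddCircle) :
    onCircle (fun z => (z : ℂ) ^ n) t = fourier n t := by
  simp [onCircle, fourier_apply, AddCircle.toCircle_zsmul]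

theorem isLInfty_zpow (n : ℤ) : IsLInfty fun z => (z : ℂ) ^ n := by
  refine .of_bound ?_ 1 fun z => ?_
  · rw [funext (onCircle_zpow n)]
    exact (fourier n).continuous.measurable
  · rw [norm_zpow, Circle.norm_coe, one_zpow]

/-- Multiplication by `z ^ n` on `L²(𝕋)`. -/
noncomputable def shift (n : ℤ) : L2T →L[ℂ] L2T := mulOp (isLInfty_zpow n)

/-- The exponential `z ^ n` as an element of `L²(𝕋)`. -/
noncomputable def monomial (n : ℤ) : L2T := fourierLp 2 n

/-- The `n`-th Fourier coefficient on `L²(𝕋)`. -/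
noncomputable def coeff (n : ℤ) : L2T →L[ℂ] ℂ := innerSL ℂ (monomial n)

theorem coeff_apply (n : ℤ) (f : L2T) : coeff n f = ⟪monomial n, f⟫_ℂ := rfl

theorem fourierCoeff_eq_coeff (n : ℤ) (f : L2T) :
    fourierCoeff (f : UnitAddCircle → ℂ) n = coeff n f := by
  rw [← fourierBasis_repr, HilbertBasis.repr_apply_apply, coe_fourierBasis]
  rfl

theorem shift_monomial (m n : ℤ) : shift m (monomial n) = monomial (m + n) := by
  apply Lp.ext
  filter_upwards [coeFn_mulOp (isLInfty_zpow m) (monomial n), coeFn_fourierLp (T := (1 : ℝ)) 2 n,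
    coeFn_fourierLp (T := (1 : ℝ)) 2 (m + n)] with t h1 h2 h3
  unfold shift
  rw [h1]
  simp only [monomial]
  rw [h2, h3, onCircle_zpow, fourier_add]

theorem conj_zpow (z : Circle) (n : ℤ) : conj ((z : ℂ) ^ n) = (z : ℂ) ^ (-n) := by
  rw [map_zpow₀, ← Circle.coe_inv_eq_conj, Circle.coe_inv, inv_zpow, zpow_neg]

theorem inner_shift_right (n : ℤ) (f k : L2T) : ⟪f, shift n k⟫_ℂ = ⟪shift (-n) f, k⟫_ℂ := by
  unfold shift
  rw [inner_mulOp_right, mulOp_congr _ (isLInfty_zpow (-n)) (fun z => conj_zpow z n)]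

theorem coeff_shift (m n : ℤ) (f : L2T) : coeff n (shift m f) = coeff (n - m) f := by
  rw [coeff_apply, inner_shift_right, shift_monomial, coeff_apply, neg_add_eq_sub]

theorem coeff_monomial (m n : ℤ) : coeff n (monomial m) = if n = m then 1 else 0 := by
  rw [coeff_apply]
  exact orthonormal_iff_ite.mp (orthonormal_fourier (T := (1 : ℝ))) n m

theorem inner_eq_tsum (f k : L2T) :
    ⟪f, k⟫_ℂ = ∑' n : ℤ, conj (coeff n f) * coeff n k := by
  rw [← HilbertBasis.tsum_inner_mul_inner (fourierBasis (T := (1 : ℝ))) f k]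
  refine tsum_congr fun n => ?_
  rw [coeff_apply, coeff_apply, inner_conj_symm, coe_fourierBasis]
  rfl

theorem eq_zero_of_coeff {f : L2T} (hf : ∀ n, coeff n f = 0) : f = 0 := by
  rw [← inner_self_eq_zero (𝕜 := ℂ), inner_eq_tsum]
  simp [hf]

/-- The squared coefficients are summable by Parseval. This decay is what permits division by a
polynomial with zeros on the circle. -/
theorem tendsto_coeff (f : L2T) :
    Filter.Tendsto (fun n => coeff n f) Filter.cofinite (nhds 0) := by
  have h := (hasSum_sq_fourierCoeff f).summable.tendsto_cofinite_zero
  rw [tendsto_zero_iff_norm_tendsto_zero]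
  have h' := (Real.continuous_sqrt.tendsto 0).comp h
  simpa [Function.comp_def, fourierCoeff_eq_coeff] using h'

/-! ### Functions with spectrum in a half-line -/

/-- Functions whose Fourier coefficients of index less than `k` vanish. -/
noncomputable def specGe (k : ℤ) : Submodule ℂ L2T := ⨅ n : {n : ℤ // n < k}, (coeff n).ker

/-- Functions whose Fourier coefficients of index at least `k` vanish. -/
noncomputable def specLt (k : ℤ) : Submodule ℂ L2T := ⨅ n : {n : ℤ // k ≤ n}, (coeff n).ker

theorem mem_specGe {k : ℤ} {f : L2T} : f ∈ specGe k ↔ ∀ n < k, coeff n f = 0 := by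
  simp [specGe]

theorem mem_specLt {k : ℤ} {f : L2T} : f ∈ specLt k ↔ ∀ n, k ≤ n → coeff n f = 0 := by
  simp [specLt]

theorem hardy_eq : hardy = specGe 0 := by
  ext f
  rw [mem_specGe]
  exact forall_congr' fun n => by rw [fourierCoeff_eq_coeff]

theorem isClosed_specGe (k : ℤ) : IsClosed (specGe k : Set L2T) := by
  simp only [specGe, Submodule.coe_iInf]
  exact isClosed_iInter fun n => (coeff n).isClosed_ker

theorem isClosed_specLt (k : ℤ) : IsClosed (specLt k : Set L2T) := by
  simp only [specLt, Submodule.coe_iInf]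
  exact isClosed_iInter fun n => (coeff n).isClosed_ker

theorem specGe_anti {j k : ℤ} (hjk : j ≤ k) : specGe k ≤ specGe j := fun _ hf =>
  mem_specGe.2 fun n hn => mem_specGe.1 hf n (hn.trans_le hjk)

theorem specLt_mono {j k : ℤ} (hjk : j ≤ k) : specLt j ≤ specLt k := fun _ hf =>
  mem_specLt.2 fun n hn => mem_specLt.1 hf n (hjk.trans hn)

theorem monomial_mem_specGe {k n : ℤ} (h : k ≤ n) : monomial n ∈ specGe k :=
  mem_specGe.2 fun m hm => by rw [coeff_monomial, if_neg (by omega)]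

theorem monomial_mem_specLt {k n : ℤ} (h : n < k) : monomial n ∈ specLt k :=
  mem_specLt.2 fun m hm => by rw [coeff_monomial, if_neg (by omega)]

theorem inner_specGe_specLt {k : ℤ} {f g : L2T} (hf : f ∈ specGe k) (hg : g ∈ specLt k) :
    ⟪f, g⟫_ℂ = 0 := by
  rw [inner_eq_tsum, ← tsum_zero]
  refine tsum_congr fun n => ?_
  rcases lt_or_ge n k with h | h
  · rw [mem_specGe.1 hf n h]; simp
  · rw [mem_specLt.1 hg n h]; simp

theorem orthogonal_specGe (k : ℤ) : (specGe k)ᗮ = specLt k := by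
  ext f
  constructor
  · intro hf
    exact mem_specLt.2 fun n hn => hf _ (monomial_mem_specGe hn)
  · intro hf g hg
    exact inner_specGe_specLt hg hf

theorem eq_zero_of_mem_specGe_of_mem_specLt {k : ℤ} {f : L2T} (hf : f ∈ specGe k)
    (hf' : f ∈ specLt k) : f = 0 :=
  inner_self_eq_zero.1 (inner_specGe_specLt hf hf')

theorem shift_mem_specLt {k : ℤ} (m : ℤ) {f : L2T} (hf : f ∈ specLt k) :
    shift m f ∈ specLt (k + m) :=
  mem_specLt.2 fun n hn => by rw [coeff_shift]; exact mem_specLt.1 hf _ (by omega)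

theorem specGe_inf_specLt_le_span (N : ℕ) :
    specGe 0 ⊓ specLt N ≤ Submodule.span ℂ (Set.range fun i : Fin N => monomial i) := by
  rintro f ⟨hf, hf'⟩
  have : f = ∑ i : Fin N, coeff i f • monomial i := by
    rw [← sub_eq_zero]
    refine eq_zero_of_coeff fun n => ?_
    simp only [map_sub, map_sum, map_smul, coeff_monomial, smul_eq_mul, mul_ite, mul_one, mul_zero]
    by_cases hn : 0 ≤ n ∧ n < N
    · lift n to ℕ using hn.1
      have hn' : n < N := by exact_mod_cast hn.2
      rw [Finset.sum_eq_single ⟨n, hn'⟩]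
      · simp
      · intro i _ hi
        rw [if_neg]
        intro h
        exact hi (Fin.ext (by exact_mod_cast h.symm))
      · simp
    · rw [Finset.sum_eq_zero, sub_zero]
      · rcases lt_or_ge n 0 with h | h
        · exact mem_specGe.1 hf n h
        · exact mem_specLt.1 hf' n (by omega)
      · intro i _
        rw [if_neg]
        have := i.2
        omega
  rw [this]
  exact Submodule.sum_mem _ fun i _ =>
    Submodule.smul_mem _ _ (Submodule.subset_span ⟨i, rfl⟩)

/-! ### Inner functions and model spaces -/

/-- The boundary function of an inner function, normalized to be unimodular everywhere. -/
structure IsInner (u : Circle → ℂ) : Prop where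
  isLInfty : IsLInfty u
  norm_eq : ∀ z, ‖u z‖ = 1
  mulOp_monomial_zero : mulOp isLInfty (monomial 0) ∈ specGe 0

theorem isInner_one : IsInner fun _ => 1 where
  isLInfty := .of_bound measurable_const 1 (by simp)
  norm_eq := by simp
  mulOp_monomial_zero := by
    rw [mulOp_eq_smul (c := 1) _ (Filter.Eventually.of_forall fun _ => rfl), one_smul]
    exact monomial_mem_specGe le_rfl

namespace IsInner

/-- Since `u z^m = z^m (u · 1)`, the single condition on `u · 1` in `IsInner` controls every
monomial. -/
theorem coeff_mulOp_monomial {u : Circle → ℂ} (hu : IsInner u) {m n : ℤ} (h : n < m) :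
    coeff n (mulOp hu.isLInfty (monomial m)) = 0 := by
  have : monomial m = shift m (monomial 0) := by rw [shift_monomial, add_zero]
  rw [this, shift, mulOp_comm, ← shift, coeff_shift]
  exact mem_specGe.1 hu.mulOp_monomial_zero _ (by omega)

/-- Parseval writes the coefficient of `u f` at `n` as a sum over `m` of the coefficient of `f` at
`m` times that of `u z^m` at `n`; for `n < k` one of the two factors always vanishes. -/
theorem mulOp_mem_specGe {u : Circle → ℂ} (hu : IsInner u) {k : ℤ} {f : L2T} (hf : f ∈ specGe k) :
    mulOp hu.isLInfty f ∈ specGe k := by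
  refine mem_specGe.2 fun n hn => ?_
  rw [coeff_apply, inner_mulOp_right, inner_eq_tsum, ← tsum_zero]
  refine tsum_congr fun m => ?_
  rcases lt_or_ge m k with h | h
  · rw [mem_specGe.1 hf m h, mul_zero]
  · rw [coeff_apply, inner_conj_symm, ← inner_mulOp_right hu.isLInfty, ← coeff_apply,
      hu.coeff_mulOp_monomial (hn.trans_le h), zero_mul]

theorem mulOp_conj_mem_specLt {u : Circle → ℂ} (hu : IsInner u) {k : ℤ} {f : L2T} (hf : f ∈ specLt k) :
    mulOp hu.isLInfty.conj f ∈ specLt k := by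
  rw [← orthogonal_specGe]
  intro g hg
  rw [← inner_mulOp_left hu.isLInfty]
  exact inner_specGe_specLt (hu.mulOp_mem_specGe hg) hf

/-- Being orthogonal to `vH²` means that `v̄ f = z^{-m} ū f` is orthogonal to `H²`; shifting by `m`
gives the condition on `ū f`. -/
theorem mem_modelSpace {u : Circle → ℂ} (hu : IsInner u) {v : Circle → ℂ} {m : ℤ} (hv : ∀ z, v z = (z : ℂ) ^ m * u z) {f : L2T} :
    f ∈ modelSpace v ↔ f ∈ specGe 0 ∧ mulOp hu.isLInfty.conj f ∈ specLt m := by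
  have hvL : IsLInfty v := by
    rw [funext hv]
    exact (isLInfty_zpow m).mul hu.isLInfty
  have hconj : mulOp hvL.conj f = shift (-m) (mulOp hu.isLInfty.conj f) := by
    rw [shift, mulOp_mulOp]
    refine mulOp_congr _ _ (fun z => ?_) f
    rw [hv, map_mul, conj_zpow]
  rw [modelSpace, Submodule.mem_inf, hardy_eq, mulSpace_eq_map hvL]
  refine and_congr_right fun _ => ?_
  have h1 : f ∈ ((specGe 0).map (mulOp hvL : L2T →ₗ[ℂ] L2T))ᗮ ↔ mulOp hvL.conj f ∈ specLt 0 := by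
    rw [← orthogonal_specGe, Submodule.mem_orthogonal, Submodule.mem_orthogonal]
    constructor
    · intro h g hg
      rw [← inner_mulOp_left hvL]
      exact h _ (Submodule.mem_map_of_mem hg)
    · rintro h _ ⟨g, hg, rfl⟩
      exact (inner_mulOp_left hvL g f).trans (h g hg)
  rw [h1, hconj]
  constructor
  · intro h
    refine mem_specLt.2 fun n hn => ?_
    have := mem_specLt.1 h (n - m) (by omega)
    rwa [coeff_shift, sub_neg_eq_add, sub_add_cancel] at this
  · intro h
    have := shift_mem_specLt (-m) h
    rwa [add_neg_cancel] at this

end IsInner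

/-! ### Multiplication by polynomials with zeros on the circle -/

theorem isLInfty_pTilde {N : ℕ} (w : Fin N → Circle) : IsLInfty (pTilde w) := by
  refine .of_bound ?_ (2 ^ N) fun z => ?_
  · have : Continuous (onCircle (pTilde w)) := by
      unfold onCircle pTilde
      exact continuous_finsetProd _ fun j _ =>
        (continuous_subtype_val.comp AddCircle.continuous_toCircle).add continuous_const
    exact this.measurable
  · rw [pTilde, norm_prod]
    calc ∏ j, ‖(z : ℂ) + w j‖ ≤ ∏ _j : Fin N, (2 : ℝ) := by
          refine Finset.prod_le_prod (fun _ _ => norm_nonneg _) fun j _ => ?_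
          refine (norm_add_le _ _).trans ?_
          rw [Circle.norm_coe, Circle.norm_coe]
          norm_num
      _ = 2 ^ N := by simp

theorem coeff_mulOp_pTilde_succ {N : ℕ} (w : Fin (N + 1) → Circle) (n : ℤ) (f : L2T) :
    coeff n (mulOp (isLInfty_pTilde w) f) =
      coeff (n - 1) (mulOp (isLInfty_pTilde (Fin.tail w)) f) +
        w 0 * coeff n (mulOp (isLInfty_pTilde (Fin.tail w)) f) := by
  have : mulOp (isLInfty_pTilde w) f = shift 1 (mulOp (isLInfty_pTilde (Fin.tail w)) f) +
      (w 0 : ℂ) • mulOp (isLInfty_pTilde (Fin.tail w)) f := by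
    set F := mulOp (isLInfty_pTilde (Fin.tail w)) f with hF
    apply Lp.ext
    filter_upwards [coeFn_mulOp (isLInfty_pTilde w) f,
      Lp.coeFn_add (shift 1 F) ((w 0 : ℂ) • F), Lp.coeFn_smul (w 0 : ℂ) F,
      coeFn_mulOp (isLInfty_zpow 1) F,
      coeFn_mulOp (isLInfty_pTilde (Fin.tail w)) f] with t h1 h2 h3 h4 h5
    rw [h1, h2, Pi.add_apply, h3, Pi.smul_apply, shift, h4, h5, smul_eq_mul]
    simp only [onCircle, pTilde, Fin.prod_univ_succ, zpow_one, Fin.tail]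
    ring
  rw [this, map_add, map_smul, coeff_shift, smul_eq_mul]

theorem mulOp_pTilde_zero (w : Fin 0 → Circle) (f : L2T) :
    mulOp (isLInfty_pTilde w) f = f := by
  rw [mulOp_eq_smul (c := 1) _ (Filter.Eventually.of_forall fun t => by simp [onCircle, pTilde]),
    one_smul]

theorem mulOp_pTilde_mem_specGe {N : ℕ} (w : Fin N → Circle) {k : ℤ} {f : L2T}
    (hf : f ∈ specGe k) : mulOp (isLInfty_pTilde w) f ∈ specGe k := by
  induction N with
  | zero => rwa [mulOp_pTilde_zero]
  | succ N ih =>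
    have h := mem_specGe.1 (ih (Fin.tail w))
    refine mem_specGe.2 fun n hn => ?_
    rw [coeff_mulOp_pTilde_succ, h _ (by omega), h _ hn, mul_zero, add_zero]

/-- The lowest coefficient of a product is the product of the lowest coefficients, and the constant
term of `pTilde w` is `∏ wⱼ`. -/
theorem coeff_mulOp_pTilde {N : ℕ} (w : Fin N → Circle) {k : ℤ} {f : L2T} (hf : f ∈ specGe k) :
    coeff k (mulOp (isLInfty_pTilde w) f) = (∏ j, (w j : ℂ)) * coeff k f := by
  induction N with
  | zero => simp [mulOp_pTilde_zero]
  | succ N ih =>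
    rw [coeff_mulOp_pTilde_succ, ih,
      mem_specGe.1 (mulOp_pTilde_mem_specGe (Fin.tail w) hf) _ (by omega), Fin.prod_univ_succ,
      zero_add, mul_assoc]
    rfl

theorem mulOp_pTilde_mem_specLt {N : ℕ} (w : Fin N → Circle) {k : ℤ} {f : L2T}
    (hf : f ∈ specLt k) : mulOp (isLInfty_pTilde w) f ∈ specLt (k + N) := by
  induction N with
  | zero => simpa [mulOp_pTilde_zero]
  | succ N ih =>
    have h := mem_specLt.1 (ih (Fin.tail w))
    refine mem_specLt.2 fun n hn => ?_
    push_cast at hn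
    rw [coeff_mulOp_pTilde_succ, h _ (by omega), h _ (by omega), mul_zero, add_zero]

/-- Division by a polynomial with zeros on the circle lowers the degree: the Fourier coefficients
satisfy a recursion of unimodular ratio, and they tend to zero. -/
theorem mem_specLt_of_mulOp_pTilde {N : ℕ} (w : Fin N → Circle) {k : ℤ} {f : L2T}
    (hf : mulOp (isLInfty_pTilde w) f ∈ specLt (k + N)) : f ∈ specLt k := by
  induction N with
  | zero => simpa [mulOp_pTilde_zero] using hf
  | succ N ih =>
    refine ih (Fin.tail w) ?_
    set F := mulOp (isLInfty_pTilde (Fin.tail w)) f with hF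
    have hrec : ∀ n, k + N ≤ n → ‖coeff n F‖ = ‖coeff (n + 1) F‖ := by
      intro n hn
      have h := mem_specLt.1 hf (n + 1) (by push_cast; omega)
      rw [coeff_mulOp_pTilde_succ, add_sub_cancel_right] at h
      rw [eq_neg_of_add_eq_zero_left h, norm_neg, norm_mul, Circle.norm_coe, one_mul]
    refine mem_specLt.2 fun n hn => ?_
    have hconst : ∀ m : ℕ, ‖coeff (n + m) F‖ = ‖coeff n F‖ := by
      intro m
      induction m with
      | zero => simp
      | succ m ihm =>
        rw [← ihm, hrec (n + m) (by omega)]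
        push_cast
        rw [add_assoc]
    have hinj : Function.Injective fun m : ℕ => n + (m : ℤ) := fun a b hab => by
      simpa using hab
    have hlim := ((tendsto_coeff F).comp hinj.tendsto_cofinite).norm
    simp only [Function.comp_def, hconst, norm_zero] at hlim
    exact norm_eq_zero.1 (tendsto_nhds_unique tendsto_const_nhds hlim)

/-- Each factor satisfies `z + w = w z conj (z + w)`, because `z` and `w` are unimodular. -/
theorem pTilde_eq_conj {N : ℕ} (w : Fin N → Circle) (z : Circle) :
    pTilde w z = (∏ j, (w j : ℂ)) * ((z : ℂ) ^ (N : ℤ) * conj (pTilde w z)) := by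
  have hz : (z : ℂ) * conj (z : ℂ) = 1 := by rw [Complex.mul_conj', Circle.norm_coe]; simp
  have : (z : ℂ) ^ (N : ℤ) = ∏ _j : Fin N, (z : ℂ) := by simp
  rw [this, pTilde, map_prod, ← Finset.prod_mul_distrib, ← Finset.prod_mul_distrib]
  refine Finset.prod_congr rfl fun j _ => ?_
  have hw : (w j : ℂ) * conj (w j : ℂ) = 1 := by rw [Complex.mul_conj', Circle.norm_coe]; simp
  rw [map_add]
  linear_combination -(w j : ℂ) * hz - z * hw

theorem mulOp_pTilde_eq {N : ℕ} (w : Fin N → Circle) (f : L2T) :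
    mulOp (isLInfty_pTilde w) f =
      (∏ j, (w j : ℂ)) • shift N (mulOp (isLInfty_pTilde w).conj f) := by
  set F := mulOp (isLInfty_pTilde w).conj f with hF
  apply Lp.ext
  filter_upwards [coeFn_mulOp (isLInfty_pTilde w) f, Lp.coeFn_smul (∏ j, (w j : ℂ)) (shift N F),
    coeFn_mulOp (isLInfty_zpow N) F, coeFn_mulOp (isLInfty_pTilde w).conj f] with t h1 h2 h3 h4
  rw [h1, h2, Pi.smul_apply, shift, h3, h4, smul_eq_mul]
  simp only [onCircle]
  linear_combination f t * pTilde_eq_conj w (toCircle t)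

/-! ### The singular inner function -/

theorem fourierCoeff_onCircle (Φ : ℂ → ℂ) (n : ℤ) :
    fourierCoeff (onCircle fun z => Φ z) n =
      Real.circleAverage (fun z => z ^ (-n) * Φ z) 0 1 := by
  have hcircle : ∀ x : ℝ, ((toCircle (x : UnitAddCircle) : Circle) : ℂ) =
      circleMap 0 1 (2 * Real.pi * x) := by
    intro x
    rw [AddCircle.toCircle_apply_mk, Circle.coe_exp, circleMap]
    simp
  rw [fourierCoeff_eq_intervalIntegral _ n 0, Real.circleAverage_def]
  have h := intervalIntegral.integral_comp_mul_left (a := 0) (b := 1)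
    (fun θ => circleMap 0 1 θ ^ (-n) * Φ (circleMap 0 1 θ)) (c := 2 * Real.pi) (by positivity)
  rw [mul_zero, mul_one] at h
  rw [← h, zero_add, div_one, one_smul]
  refine intervalIntegral.integral_congr fun x _ => ?_
  simp only [← onCircle_zpow, onCircle, hcircle, smul_eq_mul]

theorem re_cayley_nonneg {ζ : ℂ} (h : ‖ζ‖ ≤ 1) : 0 ≤ ((1 - ζ) / (1 + ζ)).re := by
  have h' : ζ.re * ζ.re + ζ.im * ζ.im ≤ 1 := by
    rw [← Complex.normSq_apply, Complex.normSq_eq_norm_sq]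
    exact pow_le_one₀ (norm_nonneg _) h
  rw [Complex.div_re, ← add_div]
  refine div_nonneg ?_ (Complex.normSq_nonneg _)
  simp only [Complex.sub_re, Complex.add_re, Complex.sub_im, Complex.add_im, Complex.one_re,
    Complex.one_im]
  linarith

theorem re_cayley_eq_zero {ζ : ℂ} (h : ‖ζ‖ = 1) : ((1 - ζ) / (1 + ζ)).re = 0 := by
  have h' : ζ.re * ζ.re + ζ.im * ζ.im = 1 := by
    rw [← Complex.normSq_apply, Complex.normSq_eq_norm_sq, h, one_pow]
  rw [Complex.div_re, ← add_div]
  simp only [Complex.sub_re, Complex.add_re, Complex.sub_im, Complex.add_im, Complex.one_re,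
    Complex.one_im]
  rw [div_eq_zero_iff]
  left
  linarith

theorem norm_exp_cayley (δ : ℝ) (ζ : ℂ) :
    ‖Complex.exp (-(δ : ℂ) * ((1 - ζ) / (1 + ζ)))‖ =
      Real.exp (-δ * ((1 - ζ) / (1 + ζ)).re) := by
  rw [Complex.norm_exp, ← Complex.ofReal_neg, Complex.re_ofReal_mul]

theorem norm_phi (δ : ℝ) (z : Circle) : ‖phi δ z‖ = 1 := by
  rw [phi, norm_exp_cayley, re_cayley_eq_zero (Circle.norm_coe z), mul_zero, Real.exp_zero]

theorem measurable_onCircle_exp_cayley (δ : ℝ) (r : ℂ) :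
    Measurable (onCircle fun z =>
      Complex.exp (-(δ : ℂ) * ((1 - r * (z : ℂ)) / (1 + r * (z : ℂ))))) := by
  have h : Measurable fun t : UnitAddCircle => ((toCircle t : Circle) : ℂ) :=
    (continuous_subtype_val.comp AddCircle.continuous_toCircle).measurable
  unfold onCircle
  fun_prop

theorem isLInfty_phi (δ : ℝ) : IsLInfty (phi δ) := by
  refine .of_bound ?_ 1 fun z => (norm_phi δ z).le
  have := measurable_onCircle_exp_cayley δ 1
  simp only [one_mul] at this
  exact this

/-- The dilate by `r < 1` is holomorphic near the closed disc, its only singularity being outside.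
The coefficient is a circle average, hence by the mean value property the value at `0` of a function
carrying a positive power of `z`. -/
theorem fourierCoeff_exp_cayley_mul (δ : ℝ) {r : ℝ} (hr : 0 ≤ r) (hr1 : r < 1) {n : ℤ}
    (hn : n < 0) :
    fourierCoeff (onCircle fun z =>
      Complex.exp (-(δ : ℂ) * ((1 - r * (z : ℂ)) / (1 + r * (z : ℂ))))) n = 0 := by
  rw [fourierCoeff_onCircle fun z => Complex.exp (-(δ : ℂ) * ((1 - r * z) / (1 + r * z)))]
  obtain ⟨m, rfl⟩ : ∃ m : ℕ, n = -(m + 1 : ℕ) := ⟨(-n - 1).toNat, by omega⟩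
  have hd : DifferentiableOn ℂ (fun z : ℂ => z ^ (-(-((m + 1 : ℕ) : ℤ))) *
      Complex.exp (-(δ : ℂ) * ((1 - r * z) / (1 + r * z)))) (Metric.closedBall 0 1) := by
    simp only [neg_neg, zpow_natCast]
    intro z hz
    have hz' : ‖z‖ ≤ 1 := by simpa using hz
    have hne : 1 + r * z ≠ 0 := by
      intro h0
      have h1 : ‖(r : ℂ) * z‖ = 1 := by rw [eq_neg_of_add_eq_zero_right h0]; simp
      rw [norm_mul, Complex.norm_real, Real.norm_of_nonneg hr] at h1
      nlinarith [norm_nonneg z]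
    refine DifferentiableAt.differentiableWithinAt ?_
    fun_prop (disch := exact hne)
  rw [DiffContOnCl.circleAverage]
  · rw [neg_neg, zpow_natCast, zero_pow (Nat.succ_ne_zero m), zero_mul]
  · refine DifferentiableOn.diffContOnCl ?_
    rw [abs_one]
    exact hd.mono Metric.closure_ball_subset_closedBall

theorem ae_toCircle_ne (w : Circle) :
    ∀ᵐ t ∂(haarAddCircle (T := (1 : ℝ))), toCircle t ≠ w := by
  have hnull : volume {t : UnitAddCircle | toCircle t = w} = 0 := by
    rcases Set.eq_empty_or_nonempty {t : UnitAddCircle | toCircle t = w} with h | ⟨s, hs⟩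
    · rw [h, measure_empty]
    · refine measure_mono_null (t := Metric.closedBall s 0) (fun t ht => ?_) ?_
      · rw [AddCircle.injective_toCircle one_ne_zero (Eq.trans ht hs.symm)]
        exact Metric.mem_closedBall_self le_rfl
      · rw [AddCircle.volume_closedBall]
        simp
  rw [volume_eq_smul_haarAddCircle, ENNReal.ofReal_one, one_smul] at hnull
  simpa [ae_iff] using hnull

/-- Let `r → 1` in the dilates: they are bounded by `1`, as the Cayley transform has nonnegative
real part on the disc, and they converge off the null set `{-1}`. -/
theorem fourierCoeff_phi {δ : ℝ} (hδ : 0 ≤ δ) {n : ℤ} (hn : n < 0) :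
    fourierCoeff (onCircle (phi δ)) n = 0 := by
  obtain ⟨r, -, hr, hlim⟩ := exists_seq_strictMono_tendsto' (zero_lt_one' ℝ)
  have key : Filter.Tendsto (fun j => fourierCoeff (onCircle fun z =>
      Complex.exp (-(δ : ℂ) * ((1 - r j * (z : ℂ)) / (1 + r j * (z : ℂ))))) n) Filter.atTop
      (nhds (fourierCoeff (onCircle (phi δ)) n)) := by
    refine tendsto_integral_of_dominated_convergence (fun _ => 1) (fun j => ?_)
      (integrable_const _) (fun j => ?_) ?_
    · exact ((fourier (-n)).continuous.measurable.smul
        (measurable_onCircle_exp_cayley δ (r j))).aestronglyMeasurable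
    · refine Filter.Eventually.of_forall fun t => ?_
      rw [norm_smul, fourier_apply, Circle.norm_coe, one_mul]
      simp only [onCircle]
      rw [norm_exp_cayley]
      refine Real.exp_le_one_iff.2 ?_
      have := re_cayley_nonneg (ζ := r j * (toCircle t : ℂ)) (by
        rw [norm_mul, Complex.norm_real, Circle.norm_coe, mul_one,
          Real.norm_of_nonneg (hr j).1.le]
        exact (hr j).2.le)
      nlinarith
    · filter_upwards [ae_toCircle_ne (-1)] with t ht
      have hne : 1 + (1 : ℂ) * (toCircle t : ℂ) ≠ 0 := by
        intro h0
        rw [one_mul] at h0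
        refine ht (Circle.ext ?_)
        rw [eq_neg_of_add_eq_zero_right h0]
        simp
      have hr' : Filter.Tendsto (fun j => (r j : ℂ)) Filter.atTop (nhds 1) := by
        have := (Complex.continuous_ofReal.tendsto 1).comp hlim
        simpa [Function.comp_def] using this
      have hmul := hr'.mul_const (toCircle t : ℂ)
      have h := (Complex.continuous_exp.tendsto _).comp
        ((((hmul.const_sub 1).div (hmul.const_add 1) hne)).const_mul (-(δ : ℂ)))
      simp only [one_mul] at h
      exact h.const_smul _
  refine tendsto_nhds_unique key ?_
  simp only [fun j => fourierCoeff_exp_cayley_mul δ (hr j).1.le (hr j).2 hn]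
  exact tendsto_const_nhds

theorem isInner_phi {δ : ℝ} (hδ : 0 ≤ δ) : IsInner (phi δ) where
  isLInfty := isLInfty_phi δ
  norm_eq := norm_phi δ
  mulOp_monomial_zero := by
    refine mem_specGe.2 fun n hn => ?_
    rw [← fourierCoeff_eq_coeff, ← fourierCoeff_phi hδ hn]
    refine congrFun (fourierCoeff_congr_ae ?_) n
    filter_upwards [coeFn_mulOp (isLInfty_phi δ) (monomial 0),
      coeFn_fourierLp (T := (1 : ℝ)) 2 0] with t h1 h2
    rw [h1]
    simp only [monomial]
    rw [h2, fourier_zero, mul_one]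

/-! ### Polynomial multiples of model spaces -/

/-- The space splits orthogonally as `U ⊕ (Uᗮ ⊓ V) ⊕ Vᗮ`, and the hypothesis kills the middle
component of `x`. -/
theorem exists_add_of_orthogonal_orthogonal_inf {E : Type*} [NormedAddCommGroup E]
    [InnerProductSpace ℂ E] {U V : Submodule ℂ E} [U.HasOrthogonalProjection]
    [V.HasOrthogonalProjection] (hUV : U ≤ V) {x : E} (hx : ∀ y ∈ Uᗮ ⊓ V, ⟪y, x⟫_ℂ = 0) :
    ∃ a ∈ U, ∃ m ∈ Vᗮ, x = a + m := by
  have htop : x ∈ V ⊔ Vᗮ := by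
    rw [Submodule.sup_orthogonal_of_hasOrthogonalProjection]
    exact Submodule.mem_top
  obtain ⟨g, hg, m, hm, rfl⟩ := Submodule.mem_sup.1 htop
  rw [← Submodule.sup_orthogonal_inf_of_hasOrthogonalProjection hUV] at hg
  obtain ⟨a, ha, y, hy, rfl⟩ := Submodule.mem_sup.1 hg
  have h := hx y hy
  rw [inner_add_right, inner_add_right, Submodule.inner_left_of_mem_orthogonal ha hy.1,
    Submodule.inner_right_of_mem_orthogonal hy.2 hm, zero_add, add_zero] at h
  exact ⟨a, ha, m, hm, by rw [inner_self_eq_zero.1 h, add_zero]⟩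

namespace IsInner

theorem isClosed_modelSpace {u : Circle → ℂ} (hu : IsInner u)
    {v : Circle → ℂ} {m : ℤ} (hv : ∀ z, v z = (z : ℂ) ^ m * u z) :
    IsClosed (modelSpace v : Set L2T) := by
  have : (modelSpace v : Set L2T) =
      (specGe 0 : Set L2T) ∩ mulOp hu.isLInfty.conj ⁻¹' (specLt m : Set L2T) :=
    Set.ext fun f => hu.mem_modelSpace hv
  rw [this]
  exact (isClosed_specGe 0).inter
    ((isClosed_specLt m).preimage (mulOp hu.isLInfty.conj).continuous)

/-- A function orthogonal to `K_{zu}` is the sum of a function in `zuH²` and one orthogonal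
to `H²`. -/
theorem exists_add_of_orthogonal_modelSpace {u : Circle → ℂ} (hu : IsInner u) {X : L2T}
    (hX : ∀ f ∈ specGe 0, mulOp hu.isLInfty.conj f ∈ specLt 1 → ⟪f, X⟫_ℂ = 0) :
    ∃ a m, mulOp hu.isLInfty.conj a ∈ specGe 1 ∧ m ∈ specLt 0 ∧ X = a + m := by
  -- This is `zuH²`, written as a preimage under multiplication by `ū` so that closedness is
  -- immediate.
  set U : Submodule ℂ L2T :=
    (specGe 1).comap (mulOp hu.isLInfty.conj : L2T →ₗ[ℂ] L2T) with hU
  have hUclosed : IsClosed (U : Set L2T) :=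
    (isClosed_specGe 1).preimage (mulOp hu.isLInfty.conj).continuous
  have hUle : U ≤ specGe 0 := fun f hf => by
    rw [← mulOp_mulOp_conj hu.isLInfty hu.norm_eq f]
    exact hu.mulOp_mem_specGe (specGe_anti zero_le_one hf)
  have := hUclosed.completeSpace_coe
  have := (isClosed_specGe 0).completeSpace_coe
  obtain ⟨a, ha, m, hm, hXam⟩ := exists_add_of_orthogonal_orthogonal_inf hUle (x := X) <| by
    rintro y ⟨hyU, hy⟩
    refine hX y hy ?_
    rw [← orthogonal_specGe]
    intro g hg
    rw [← inner_mulOp_left hu.isLInfty]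
    refine hyU _ (Submodule.mem_comap.2 ?_)
    rw [ContinuousLinearMap.coe_coe, mulOp_conj_mulOp hu.isLInfty hu.norm_eq]
    exact hg
  rw [orthogonal_specGe] at hm
  exact ⟨a, m, Submodule.mem_comap.1 ha, hm, hXam⟩

theorem eq_zero_of_orthogonal {u : Circle → ℂ} (hu : IsInner u) {N : ℕ}
    (w : Fin N → Circle) {F : L2T} (hF : F ∈ specGe 0)
    (hFu : mulOp hu.isLInfty.conj F ∈ specLt (N + 1))
    (hlow : ∀ k : ℤ, 0 ≤ k → k < N → coeff k (mulOp hu.isLInfty.conj F) = 0)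
    (horth : ∀ f ∈ specGe 0, mulOp hu.isLInfty.conj f ∈ specLt 1 →
      ⟪mulOp (isLInfty_pTilde w) f, F⟫_ℂ = 0) : F = 0 := by
  obtain ⟨a, m, ha, hm, hX⟩ := hu.exists_add_of_orthogonal_modelSpace
    (X := mulOp (isLInfty_pTilde w).conj F) fun f hf hf' => by
      rw [← inner_mulOp_left (isLInfty_pTilde w)]
      exact horth f hf hf'
  have hC : (∏ j, (w j : ℂ)) ≠ 0 := Finset.prod_ne_zero_iff.2 fun j _ => Circle.coe_ne_zero _
  set C := ∏ j, (w j : ℂ) with hCdef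
  have hpF : mulOp (isLInfty_pTilde w) F = C • shift N (a + m) := by
    rw [← hX]; exact mulOp_pTilde_eq w F
  set G := mulOp hu.isLInfty.conj F with hG
  have hum := hu.mulOp_conj_mem_specLt hm
  have hpG : ∀ n : ℤ, coeff (n + N) (mulOp (isLInfty_pTilde w) G) =
      C * (coeff n (mulOp hu.isLInfty.conj a) + coeff n (mulOp hu.isLInfty.conj m)) := by
    intro n
    rw [hG, mulOp_comm, hpF, map_smul, shift, mulOp_comm, ← shift, map_smul, coeff_shift,
      map_add, map_add, add_sub_cancel_right, smul_eq_mul]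
  -- The coefficients of `G` vanish at `0, …, N-1` and above `N`, so `N` is the only possible
  -- nonnegative index.
  have hG' : G - coeff N G • monomial N ∈ specLt 0 := by
    refine mem_specLt.2 fun n hn => ?_
    rw [map_sub, map_smul, coeff_monomial]
    rcases lt_trichotomy n N with h | h | h
    · rw [hlow n hn h, if_neg h.ne]; simp
    · subst h; simp
    · rw [mem_specLt.1 hFu n (by omega), if_neg h.ne']; simp
  -- The coefficient of `p G` at `N` is zero, since `ū a` starts at index `1` and `ū m` ends below
  -- `0`. It also equals `C * coeff N G`, because `p` times the negative part of `G` stays below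
  -- `N`.
  have hGN : coeff N G = 0 := by
    have h0 := hpG 0
    rw [mem_specGe.1 ha 0 zero_lt_one, mem_specLt.1 hum 0 le_rfl, zero_add, add_zero,
      mul_zero] at h0
    have h1 := mem_specLt.1 (mulOp_pTilde_mem_specLt w hG') N (by omega)
    rw [map_sub, map_sub, h0, map_smul, map_smul,
      coeff_mulOp_pTilde w (monomial_mem_specGe le_rfl), coeff_monomial, if_pos rfl, zero_sub,
      neg_eq_zero, mul_one, smul_eq_mul] at h1
    exact (mul_eq_zero.1 h1).resolve_right hC
  rw [hGN, zero_smul, sub_zero] at hG'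
  -- Now `p G` has spectrum below `N`, so `ū a + ū m` has no coefficient of index `≥ 0`, which is
  -- where all of `ū a` lives.
  have ha0 : mulOp hu.isLInfty.conj a = 0 := by
    refine eq_zero_of_mem_specGe_of_mem_specLt (k := 0) (specGe_anti zero_le_one ha) ?_
    refine mem_specLt.2 fun n hn => ?_
    have h := hpG n
    rw [mem_specLt.1 (mulOp_pTilde_mem_specLt w hG') _ (by omega), mem_specLt.1 hum n hn,
      add_zero] at h
    exact (mul_eq_zero.1 h.symm).resolve_left hC
  have ha0' : a = 0 := by
    rw [← mulOp_mulOp_conj hu.isLInfty hu.norm_eq a, ha0, map_zero]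
  rw [ha0', zero_add] at hpF
  refine eq_zero_of_mem_specGe_of_mem_specLt hF (mem_specLt_of_mulOp_pTilde w ?_)
  rw [hpF]
  exact Submodule.smul_mem _ _ (shift_mem_specLt _ hm)

theorem mem_modelSpace_pow {N : ℕ} {f : L2T} :
    f ∈ modelSpace (fun z => (z : ℂ) ^ N) ↔ f ∈ specGe 0 ∧ f ∈ specLt N := by
  rw [isInner_one.mem_modelSpace (m := N) (fun z => by rw [zpow_natCast, mul_one]),
    mulOp_eq_smul (c := 1) _ (Filter.Eventually.of_forall fun _ => by simp [onCircle]), one_smul]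

theorem modelSpace_pow_le_span (N : ℕ) :
    modelSpace (fun z => (z : ℂ) ^ N) ≤
      Submodule.span ℂ (Set.range fun i : Fin N => monomial i) := fun _ hf =>
  specGe_inf_specLt_le_span N (mem_modelSpace_pow.1 hf)

theorem rank_modelSpace_pow_le (N : ℕ) :
    Module.rank ℂ (modelSpace fun z => (z : ℂ) ^ N) ≤ N :=
  (Submodule.rank_mono (modelSpace_pow_le_span N)).trans <|
    (rank_span_le _).trans <| Cardinal.mk_range_le.trans <| by simp

theorem closure_pTilde_sup {u : Circle → ℂ} (hu : IsInner u) {N : ℕ} (w : Fin N → Circle) :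
    ((modelSpace fun z => (z : ℂ) * u z).map
        (mulOp (isLInfty_pTilde w) : L2T →ₗ[ℂ] L2T)).topologicalClosure ⊔
      (modelSpace fun z => (z : ℂ) ^ N).map (mulOp hu.isLInfty : L2T →ₗ[ℂ] L2T) =
    modelSpace fun z => (z : ℂ) ^ (N + 1) * u z := by
  have hv1 : ∀ z : Circle, (z : ℂ) * u z = (z : ℂ) ^ (1 : ℤ) * u z := fun z => by rw [zpow_one]
  have hvN : ∀ z : Circle, (z : ℂ) ^ (N + 1) * u z = (z : ℂ) ^ ((N : ℤ) + 1) * u z := fun z => by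
    rw [← zpow_natCast]; push_cast; rfl
  set A := (modelSpace fun z => (z : ℂ) * u z).map
    (mulOp (isLInfty_pTilde w) : L2T →ₗ[ℂ] L2T) with hA
  set B := (modelSpace fun z => (z : ℂ) ^ N).map (mulOp hu.isLInfty : L2T →ₗ[ℂ] L2T) with hB
  have hAle : A ≤ modelSpace fun z => (z : ℂ) ^ (N + 1) * u z := by
    rintro _ ⟨f, hf, rfl⟩
    rw [SetLike.mem_coe, hu.mem_modelSpace hv1] at hf
    refine (hu.mem_modelSpace hvN).2 ⟨mulOp_pTilde_mem_specGe w hf.1, ?_⟩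
    have := mulOp_pTilde_mem_specLt w hf.2
    rw [mulOp_comm, add_comm] at this
    exact this
  have hBle : B ≤ modelSpace fun z => (z : ℂ) ^ (N + 1) * u z := by
    rintro _ ⟨f, hf, rfl⟩
    rw [SetLike.mem_coe, mem_modelSpace_pow] at hf
    refine (hu.mem_modelSpace hvN).2 ⟨hu.mulOp_mem_specGe hf.1, ?_⟩
    have := specLt_mono (by omega : (N : ℤ) ≤ N + 1) hf.2
    rw [← mulOp_conj_mulOp hu.isLInfty hu.norm_eq f] at this
    exact this
  have : FiniteDimensional ℂ (modelSpace fun z => (z : ℂ) ^ N) :=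
    Module.rank_lt_aleph0_iff.1 ((rank_modelSpace_pow_le N).trans_lt Cardinal.natCast_lt_aleph0)
  have hle : A.topologicalClosure ⊔ B ≤ modelSpace fun z => (z : ℂ) ^ (N + 1) * u z :=
    sup_le (A.topologicalClosure_minimal hAle (hu.isClosed_modelSpace hvN)) hBle
  have hclosed : IsClosed ((A.topologicalClosure ⊔ B : Submodule ℂ L2T) : Set L2T) :=
    Submodule.isClosed_sup_finiteDimensional _ _ A.isClosed_topologicalClosure
  have := hclosed.completeSpace_coe
  -- The target is the closed sum plus its orthogonal complement in the target, so it suffices that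
  -- this complement is zero.
  rw [← Submodule.sup_orthogonal_inf_of_hasOrthogonalProjection hle, eq_comm, sup_eq_left]
  rintro F ⟨hFo, hF⟩
  rw [SetLike.mem_coe, hu.mem_modelSpace hvN] at hF
  have : F = 0 := by
    refine hu.eq_zero_of_orthogonal w hF.1 hF.2 (fun k hk hkN => ?_) fun f hf hf' => ?_
    · rw [coeff_apply, ← inner_mulOp_left hu.isLInfty]
      exact hFo _ (Submodule.mem_sup_right (Submodule.mem_map_of_mem
        (mem_modelSpace_pow.2 ⟨monomial_mem_specGe hk, monomial_mem_specLt hkN⟩)))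
    · exact hFo _ (Submodule.mem_sup_left (A.le_topologicalClosure
        (Submodule.mem_map_of_mem ((hu.mem_modelSpace hv1).2 ⟨hf, hf'⟩))))
  rw [this]
  exact Submodule.zero_mem _

end IsInner

theorem map_topologicalClosure_of_inverse {A B : L2T →L[ℂ] L2T} (hBA : ∀ f, B (A f) = f)
    (hAB : ∀ f, A (B f) = f) (M : Submodule ℂ L2T) :
    M.topologicalClosure.map (A : L2T →ₗ[ℂ] L2T) =
      (M.map (A : L2T →ₗ[ℂ] L2T)).topologicalClosure :=
  SetLike.coe_injective <|
    (ContinuousLinearEquiv.equivOfInverse A B hBA hAB).image_closure (M : Set L2T)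

theorem mulSpace_mulSpace {a b : Circle → ℂ} (ha : IsLInfty a) (hb : IsLInfty b)
    (M : Submodule ℂ L2T) : mulSpace a (mulSpace b M) = mulSpace (fun z => a z * b z) M := by
  rw [mulSpace_eq_map (ha.mul hb), mulSpace_eq_map ha, mulSpace_eq_map hb]
  ext F
  simp only [Submodule.mem_map, ContinuousLinearMap.coe_coe, exists_exists_and_eq_and,
    mulOp_mulOp]

theorem rank_mulSpace_le {a : Circle → ℂ} (ha : IsLInfty a) (M : Submodule ℂ L2T) :
    Module.rank ℂ (mulSpace a M) ≤ Module.rank ℂ M := by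
  rw [mulSpace_eq_map ha]
  exact rank_map_le _ _

/-- Modulo `C` every element of `Z` is represented by its `W` component, so `W` maps onto the
quotient. -/
theorem rank_quotient_submoduleOf_sup_le {V : Type*} [AddCommGroup V] [Module ℂ V]
    {C W Z : Submodule ℂ V} (h : C ⊔ W = Z) :
    Module.rank ℂ (Z ⧸ C.submoduleOf Z) ≤ Module.rank ℂ W := by
  have hW : W ≤ Z := h ▸ le_sup_right
  refine LinearMap.rank_le_of_surjective
    ((C.submoduleOf Z).mkQ ∘ₗ Submodule.inclusion hW) fun q => ?_
  obtain ⟨⟨z, hz⟩, rfl⟩ := Submodule.mkQ_surjective _ q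
  obtain ⟨c, hc, x, hx, rfl⟩ := Submodule.mem_sup.1 (h.symm ▸ hz)
  refine ⟨⟨x, hx⟩, ?_⟩
  rw [LinearMap.comp_apply, Submodule.mkQ_apply, Submodule.mkQ_apply, Submodule.Quotient.eq]
  change x - (c + x) ∈ C
  rw [sub_add_cancel_right]
  exact C.neg_mem hc

end DiscHardy

theorem mainTheorem2 (δ : ℝ) (hδ : 0 < δ) (N : ℕ) (hN : 1 ≤ N) (w : Fin N → Circle)
    (h : RatFunc ℂ) (hh : DiscHardy.IsInvertibleLInfty (DiscHardy.ratOnCircle h))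
    (g : Circle → ℂ) (hg : ∀ z, g z = DiscHardy.pTilde w z * DiscHardy.ratOnCircle h z) :
    -- `c(g) + h φ^δ K_{z^N} = h K_{z^{N+1} φ^δ}`
    DiscHardy.cSpace δ g ⊔
        DiscHardy.mulSpace (fun z => DiscHardy.ratOnCircle h z * DiscHardy.phi δ z)
          (DiscHardy.modelSpace fun z => (z : ℂ) ^ N) =
      DiscHardy.mulSpace (DiscHardy.ratOnCircle h)
        (DiscHardy.modelSpace fun z => (z : ℂ) ^ (N + 1) * DiscHardy.phi δ z) ∧
    -- `c(g)` is a subspace of `h K_{z^{N+1} φ^δ}` of codimension at most `N`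
    DiscHardy.cSpace δ g ≤
      DiscHardy.mulSpace (DiscHardy.ratOnCircle h)
        (DiscHardy.modelSpace fun z => (z : ℂ) ^ (N + 1) * DiscHardy.phi δ z) ∧
    Module.rank ℂ
      (↥(DiscHardy.mulSpace (DiscHardy.ratOnCircle h)
          (DiscHardy.modelSpace fun z => (z : ℂ) ^ (N + 1) * DiscHardy.phi δ z)) ⧸
        (DiscHardy.cSpace δ g).submoduleOf
          (DiscHardy.mulSpace (DiscHardy.ratOnCircle h)
            (DiscHardy.modelSpace fun z => (z : ℂ) ^ (N + 1) * DiscHardy.phi δ z))) ≤ N := by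
  open DiscHardy in
  obtain ⟨hL : IsLInfty (ratOnCircle h), k, hk : IsLInfty k, hhk⟩ := hh
  have hu := isInner_phi hδ.le
  have hhk' : ∀ᵐ t ∂(haarAddCircle (T := (1 : ℝ))),
      onCircle (fun z => ratOnCircle h z * k z) t = 1 := hhk
  have hinv : ∀ f, mulOp hL (mulOp hk f) = f := fun f => by
    rw [mulOp_mulOp, mulOp_eq_smul (hL.mul hk) hhk', one_smul]
  have hinv' : ∀ f, mulOp hk (mulOp hL f) = f := fun f => by rw [mulOp_comm, hinv]
  have hc : cSpace δ g = mulSpace (ratOnCircle h)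
      (mulSpace (pTilde w) (modelSpace fun z => (z : ℂ) * phi δ z)).topologicalClosure := by
    rw [mulSpace_eq_map hL, map_topologicalClosure_of_inverse hinv' hinv, ← mulSpace_eq_map hL,
      mulSpace_mulSpace hL (isLInfty_pTilde w), cSpace,
      mulSpace_congr fun z => (hg z).trans (mul_comm _ _)]
  have hsum : cSpace δ g ⊔
      mulSpace (fun z => ratOnCircle h z * phi δ z) (modelSpace fun z => (z : ℂ) ^ N) =
      mulSpace (ratOnCircle h) (modelSpace fun z => (z : ℂ) ^ (N + 1) * phi δ z) := by
    rw [hc, ← mulSpace_mulSpace hL hu.isLInfty, mulSpace_eq_map hL, mulSpace_eq_map hL,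
      mulSpace_eq_map hL, ← Submodule.map_sup, mulSpace_eq_map (isLInfty_pTilde w),
      mulSpace_eq_map hu.isLInfty, hu.closure_pTilde_sup w]
  exact ⟨hsum, hsum ▸ le_sup_left, (rank_quotient_submoduleOf_sup_le hsum).trans <|
    (rank_mulSpace_le (hL.mul hu.isLInfty) _).trans (IsInner.rank_modelSpace_pow_le N)⟩
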